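/- Let $M$ be a loopless matroid on a finite ground set $E$ with rank function $r$. Its independence polytope $P(M)\subset\mathbb{R}^E$ is the convex hull of the indicator vectors $v_I=\sum_{e\in I}\chi_e$ of all independent sets $I$ of $M$, where $(\chi_e)_{e\in E}$ is the standard basis of $\mathbb{R}^E$. A set $A\subseteq E$ is called indecomposable if it cannot be written as a disjoint union $A=A_1\sqcup A_2$ of two proper subsets $A_1,A_2\subsetneq A$ with $r(A)=r(A_1)+r(A_2)$. Then $P(M)$ is full-dimensional in $\mathbb{R}^E$ (its affine hull is $\mathbb{R}^E$), and the following system of inequalities is a minimal system defining $P(M)$, i.e. $P(M)$ is the set of solutions $x\in\mathbb{R}^E$ of the system, and no proper subsystem has $P(M)$ as its set of solutions: (i) $0\le x_e$, for every $e\in E$; (ii) $\sum_{e\in F}x_e\le r(F)$, for every nonempty indecomposable flat $F$ of $M$. Moreover, the intersection of $P(M)$ with the bounding hyperplane of each of these half-spaces is a facet of $P(M)$, that is, a nonempty face of dimension $\dim P(M)-1$. -/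

import Mathlib

namespace MatroidPolytope

noncomputable section

/-- The rank `r(A)` as a natural number (meaningful when the ground set is finite). -/
def rank {α : Type*} (M : Matroid α) (A : Set α) : ℕ := (M.eRk A).toNat

/-- `A` is indecomposable: it is not a disjoint union of two proper subsets whose ranks add up to
the rank of `A`. (With this definition the empty set is indecomposable.) -/
def Indecomposable {α : Type*} (M : Matroid α) (A : Set α) : Prop :=
  ¬ ∃ A₁ A₂ : Set α, A₁ ⊂ A ∧ A₂ ⊂ A ∧ A₁ ∪ A₂ = A ∧ Disjoint A₁ A₂ ∧
    rank M A = rank M A₁ + rank M A₂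

open Classical in
/-- The indicator vector `v_I` in `ℝ^E`, where `E` is the ground set. -/
def indicatorVector {α : Type*} (M : Matroid α) (I : Set α) : M.E → ℝ :=
  fun e => if (e : α) ∈ I then 1 else 0

/-- The independence polytope `P(M)`: the convex hull in `ℝ^E` of the indicator vectors of the
independent sets. -/
def indepPolytope {α : Type*} (M : Matroid α) : Set (M.E → ℝ) :=
  convexHull ℝ {v | ∃ I : Set α, M.Indep I ∧ v = indicatorVector M I}

/-- The index type of the system of inequalities: one inequality for each element of the ground
set, and one for each nonempty indecomposable flat. -/
abbrev IneqIndex {α : Type*} (M : Matroid α) : Type _ :=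
  M.E ⊕ {F : Set α // F.Nonempty ∧ M.IsFlat F ∧ Indecomposable M F}

open Classical in
/-- The smaller side of the inequality `0 ≤ x_e`, respectively `∑_{e ∈ F} x_e ≤ r(F)`. -/
def smallSide {α : Type*} (M : Matroid α) [Fintype M.E] (x : M.E → ℝ) : IneqIndex M → ℝ
  | .inl _ => 0
  | .inr F => ∑ e ∈ Finset.univ.filter (fun e : M.E => (e : α) ∈ F.1), x e

/-- The larger side of the inequality `0 ≤ x_e`, respectively `∑_{e ∈ F} x_e ≤ r(F)`. -/
def largeSide {α : Type*} (M : Matroid α) (x : M.E → ℝ) : IneqIndex M → ℝ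
  | .inl e => x e
  | .inr F => (rank M F.1 : ℝ)

/-- The half space of solutions of one inequality. -/
def halfSpace {α : Type*} (M : Matroid α) [Fintype M.E] (i : IneqIndex M) : Set (M.E → ℝ) :=
  {x | smallSide M x i ≤ largeSide M x i}

/-- The hyperplane bounding the half space of one inequality. -/
def boundingHyperplane {α : Type*} (M : Matroid α) [Fintype M.E] (i : IneqIndex M) :
    Set (M.E → ℝ) :=
  {x | smallSide M x i = largeSide M x i}

/-- The dimension of (the affine hull of) a nonempty subset of a real vector space. -/
def affineDim {V : Type*} [AddCommGroup V] [Module ℝ V] (s : Set V) : ℕ :=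
  Module.finrank ℝ (vectorSpan ℝ s)

/-- `Q` is a facet of the polytope `P`: a nonempty face (the set of maximizers over `P` of a linear
functional) of dimension one less than the dimension of `P`. -/
def IsFacet {V : Type*} [AddCommGroup V] [Module ℝ V] [TopologicalSpace V] (P Q : Set V) : Prop :=
  Q.Nonempty ∧ IsExposed ℝ P Q ∧ affineDim Q + 1 = affineDim P

end

end MatroidPolytope

/-! Validity of the system is Edmonds' theorem plus a reduction. The greedy argument
`exists_indep_dotProduct_le` peels a nonnegative weight into nested level sets. Its output is an
independent set whose weight is at least that of any point satisfying all rank inequalities; by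
separation, such nonnegative points lie in the polytope (`mem_indepPolytope_iff`). A rank inequality
for a set follows from the one for its closure, and a decomposable closure splits into pieces of
smaller rank (`le_rank_of_forall_indecomposable_flat`).

Each hyperplane cuts out a facet because a functional constant on its tight vertices is a multiple
of the normal (`eq_smul_normal_of_const`). For a flat F, adding an outside element to a basis of F
forces coefficient zero off F, and basis exchange across any proper nonempty subset of F, available
by indecomposability, forces equal coefficients on F.

Minimality: for i ≠ j some vertex is tight for i and strict for j
(`exists_indep_eq_bound_lt_bound`). Averaging such vertices and stepping outward violates i alone
(`exists_violating_only`). -/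

namespace MatroidPolytope

/-! ### Irredundant inequalities and codimension-one sets. -/

section Polyhedra

variable {ι κ : Type*}

/-- If no inequality of a finite system is implied as an equation by another one on the solution
set, then each inequality can be violated while all the others hold. -/
theorem exists_violating_only [Fintype ι] [Finite κ] (a : κ → ι → ℝ) (b : κ → ℝ) (i : κ)
    (hlt : ∃ p, (∀ j, a j ⬝ᵥ p ≤ b j) ∧ a i ⬝ᵥ p < b i)
    (heq : ∃ p, (∀ j, a j ⬝ᵥ p ≤ b j) ∧ a i ⬝ᵥ p = b i)
    (hne : ∀ j, j ≠ i → ∃ p, (∀ k, a k ⬝ᵥ p ≤ b k) ∧ a i ⬝ᵥ p = b i ∧ a j ⬝ᵥ p < b j) :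
    ∃ x, b i < a i ⬝ᵥ x ∧ ∀ j, j ≠ i → a j ⬝ᵥ x ≤ b j := by
  classical
  obtain ⟨p, hpP, hp⟩ := hlt
  have key : ∀ s : Finset κ, ∃ z, (∀ j, a j ⬝ᵥ z ≤ b j) ∧ a i ⬝ᵥ z = b i ∧
      ∀ j ∈ s, j ≠ i → a j ⬝ᵥ z < b j := by
    intro s
    induction s using Finset.induction_on with
    | empty =>
      obtain ⟨z, h1, h2⟩ := heq
      exact ⟨z, h1, h2, by simp⟩
    | insert k s _ ih =>
      obtain ⟨z, hz, hzi, hzs⟩ := ih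
      by_cases hk : k = i
      · refine ⟨z, hz, hzi, fun j hj hji => ?_⟩
        rcases Finset.mem_insert.1 hj with rfl | hj
        · exact absurd hk hji
        · exact hzs j hj hji
      · obtain ⟨y, hy, hyi, hyk⟩ := hne k hk
        -- A midpoint is strict wherever either endpoint is, and stays on hyperplane `i`.
        refine ⟨(1 / 2 : ℝ) • z + (1 / 2 : ℝ) • y, fun j => ?_, ?_, fun j hj hji => ?_⟩
        · have := hz j; have := hy j
          simp only [dotProduct_add, dotProduct_smul, smul_eq_mul]; linarith
        · simp only [dotProduct_add, dotProduct_smul, smul_eq_mul]; linarith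
        · simp only [dotProduct_add, dotProduct_smul, smul_eq_mul]
          rcases Finset.mem_insert.1 hj with rfl | hj
          · have := hz j; linarith
          · have := hzs j hj hji; have := hy j; linarith
  have := Fintype.ofFinite κ
  obtain ⟨z, -, hzi, hzs⟩ := key Finset.univ
  -- Moving from `z` away from `p` crosses hyperplane `i` at once, while the finitely many other
  -- inequalities, strict at `z`, survive a small step.
  have hev : ∀ᶠ ε : ℝ in nhdsWithin 0 (Set.Ioi 0), ∀ j, j ≠ i →
      a j ⬝ᵥ z + ε * (a j ⬝ᵥ z - a j ⬝ᵥ p) < b j := by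
    refine Filter.eventually_all.2 fun j => ?_
    by_cases hj : j = i
    · simp [hj]
    · have hc : Filter.Tendsto (fun ε : ℝ => a j ⬝ᵥ z + ε * (a j ⬝ᵥ z - a j ⬝ᵥ p))
          (nhdsWithin 0 (Set.Ioi 0)) (nhds (a j ⬝ᵥ z + 0 * (a j ⬝ᵥ z - a j ⬝ᵥ p))) :=
        Filter.Tendsto.mono_left (Continuous.tendsto (by fun_prop) 0) nhdsWithin_le_nhds
      rw [zero_mul, add_zero] at hc
      filter_upwards [hc.eventually_lt_const (hzs j (Finset.mem_univ j) hj)] with ε h _ using h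
  obtain ⟨ε, hε, hpos⟩ := (hev.and self_mem_nhdsWithin).exists
  refine ⟨z + ε • (z - p), ?_, fun j hj => ?_⟩
  · simp only [dotProduct_add, dotProduct_smul, dotProduct_sub, smul_eq_mul, hzi]
    have : 0 < ε * (b i - a i ⬝ᵥ p) := mul_pos hpos (by linarith)
    linarith
  · simp only [dotProduct_add, dotProduct_smul, dotProduct_sub, smul_eq_mul]
    exact (hε j hj).le

theorem dual_apply_eq_dotProduct [Fintype ι] [DecidableEq ι] (f : (ι → ℝ) →ₗ[ℝ] ℝ) (x : ι → ℝ) :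
    f x = (fun i => f (Pi.single i 1)) ⬝ᵥ x := by
  conv_lhs => rw [LinearMap.pi_apply_eq_sum_univ f x]
  simp only [dotProduct, smul_eq_mul]
  refine Finset.sum_congr rfl fun i _ => ?_
  rw [mul_comm]
  congr 2
  ext j
  simp [Pi.single_apply, eq_comm]

theorem mem_dualAnnihilator_vectorSpan {s : Set (ι → ℝ)} {x₀ : ι → ℝ} (hx₀ : x₀ ∈ s)
    (f : Module.Dual ℝ (ι → ℝ)) :
    f ∈ (vectorSpan ℝ s).dualAnnihilator ↔ ∀ x ∈ s, f x = f x₀ := by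
  rw [Submodule.mem_dualAnnihilator]
  constructor
  · intro h x hx
    have := h _ (vsub_mem_vectorSpan ℝ hx hx₀)
    rwa [vsub_eq_sub, map_sub, sub_eq_zero] at this
  · intro h y hy
    have hle : vectorSpan ℝ s ≤ LinearMap.ker f := by
      rw [vectorSpan_def, Submodule.span_le]
      rintro _ ⟨u, hu, v, hv, rfl⟩
      simp [h u hu, h v hv]
    exact hle hy

/-- A set on which the linear functionals that are constant are exactly the multiples of one
nonzero functional has codimension one. -/
theorem affineDim_add_one [Fintype ι] {s : Set (ι → ℝ)} (hs : s.Nonempty) {a : ι → ℝ}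
    (ha : a ≠ 0) {b : ℝ} (hab : ∀ x ∈ s, a ⬝ᵥ x = b)
    (huniq : ∀ (w : ι → ℝ) (c : ℝ), (∀ x ∈ s, w ⬝ᵥ x = c) → ∃ t : ℝ, w = t • a) :
    affineDim s + 1 = Fintype.card ι := by
  classical
  obtain ⟨x₀, hx₀⟩ := hs
  let φ : Module.Dual ℝ (ι → ℝ) := dotProductBilin ℝ ℝ a
  have hφ : ∀ x, φ x = a ⬝ᵥ x := fun x => rfl
  have hφ0 : φ ≠ 0 := by
    intro h
    refine ha (dotProduct_eq_zero a fun x => ?_)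
    rw [← hφ, h]; rfl
  have hann : (vectorSpan ℝ s).dualAnnihilator = Submodule.span ℝ {φ} := by
    ext f
    rw [mem_dualAnnihilator_vectorSpan hx₀, Submodule.mem_span_singleton]
    constructor
    · intro h
      obtain ⟨t, ht⟩ := huniq _ (f x₀) fun x hx => by
        rw [← dual_apply_eq_dotProduct f x]; exact h x hx
      refine ⟨t, LinearMap.ext fun x => ?_⟩
      rw [dual_apply_eq_dotProduct f x, ht, smul_dotProduct, LinearMap.smul_apply, hφ]
    · rintro ⟨t, rfl⟩ x hx
      simp [hφ, hab x hx, hab x₀ hx₀]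
  have := Subspace.finrank_add_finrank_dualAnnihilator_eq (vectorSpan ℝ s)
  rw [hann, finrank_span_singleton hφ0, Module.finrank_fintype_fun_eq_card] at this
  exact this

/-- A nonempty set on which only the zero functional is constant spans the whole space. -/
theorem vectorSpan_eq_top [Fintype ι] {s : Set (ι → ℝ)} (hs : s.Nonempty)
    (huniq : ∀ (w : ι → ℝ) (c : ℝ), (∀ x ∈ s, w ⬝ᵥ x = c) → w = 0) :
    vectorSpan ℝ s = ⊤ := by
  classical
  obtain ⟨x₀, hx₀⟩ := hs
  rw [← Submodule.dualAnnihilator_eq_bot_iff, eq_bot_iff]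
  intro f hf
  rw [mem_dualAnnihilator_vectorSpan hx₀] at hf
  have h0 := huniq _ (f x₀) fun x hx => by
    rw [← dual_apply_eq_dotProduct f x]; exact hf x hx
  refine (Submodule.mem_bot ℝ).2 (LinearMap.ext fun x => ?_)
  rw [dual_apply_eq_dotProduct f x, h0]; simp

end Polyhedra

/-! ### Rank, bases and exchange in indecomposable sets. -/

section Rank

variable {α : Type*} {M : Matroid α} {A B I J : Set α}

theorem rank_closure : rank M (M.closure A) = rank M A := by
  simp [rank]

theorem indep_insert_of_notMem_flat {F : Set α} (hF : M.IsFlat F) (hI : M.Indep I) (hIF : I ⊆ F)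
    {e : α} (he : e ∈ M.E) (heF : e ∉ F) : M.Indep (insert e I) := by
  have hcl : e ∉ M.closure I := fun h => heF (hF.closure ▸ M.closure_subset_closure hIF h)
  exact (hI.insert_indep_iff).2 (Or.inl ⟨he, hcl⟩)

variable [M.Finite]

theorem cast_rank : (rank M A : ℕ∞) = M.eRk A :=
  ENat.natCast_toNat (Matroid.eRk_ne_top_iff.2 (M.isRkFinite_set A))

theorem rank_mono (h : A ⊆ B) : rank M A ≤ rank M B := by
  have := M.eRk_mono h
  rw [← cast_rank, ← cast_rank] at this
  exact_mod_cast this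

theorem rank_union_le : rank M (A ∪ B) ≤ rank M A + rank M B := by
  have := M.eRk_union_le_eRk_add_eRk A B
  rw [← cast_rank, ← cast_rank, ← cast_rank] at this
  exact_mod_cast this

theorem finite_of_indep (hI : M.Indep I) : I.Finite :=
  M.ground_finite.subset hI.subset_ground

theorem ncard_le_rank (hI : M.Indep I) (hIA : I ⊆ A) : I.ncard ≤ rank M A := by
  have := hI.encard_le_eRk_of_subset hIA
  rw [← cast_rank, ← (finite_of_indep hI).cast_ncard_eq] at this
  exact_mod_cast this

theorem exists_basis_extending (hI : M.Indep I) (hIA : I ⊆ A) :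
    ∃ J, I ⊆ J ∧ J ⊆ A ∧ M.Indep J ∧ J.ncard = rank M A := by
  obtain ⟨J, hJ, hIJ⟩ := hI.subset_isBasis'_of_subset hIA
  refine ⟨J, hIJ, hJ.subset, hJ.indep, ?_⟩
  have := hJ.encard_eq_eRk
  rw [← cast_rank, ← (finite_of_indep hJ.indep).cast_ncard_eq] at this
  exact_mod_cast this

theorem exists_basis (A : Set α) : ∃ J, J ⊆ A ∧ M.Indep J ∧ J.ncard = rank M A := by
  obtain ⟨J, -, h⟩ := exists_basis_extending M.empty_indep (Set.empty_subset A)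
  exact ⟨J, h⟩

theorem rank_pos [M.Loopless] (hA : A ⊆ M.E) (hne : A.Nonempty) : 0 < rank M A := by
  obtain ⟨e, he⟩ := hne
  have hi : M.Indep {e} := Matroid.indep_singleton.2 (M.isNonloop_of_loopless (hA he))
  have := ncard_le_rank hi (Set.singleton_subset_iff.2 he)
  rwa [Set.ncard_singleton] at this

/-- Subadditivity gives the weak inequality; equality would be a decomposition. -/
theorem Indecomposable.rank_lt {F : Set α} (hF : Indecomposable M F) (hAF : A ⊆ F)
    (hA : A.Nonempty) (hne : A ≠ F) : rank M F < rank M A + rank M (F \ A) := by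
  have hunion : A ∪ F \ A = F := Set.union_sdiff_cancel hAF
  refine lt_of_le_of_ne ?_ fun h => hF ⟨A, F \ A, hAF.ssubset_of_ne hne, ?_, hunion,
    Set.disjoint_sdiff_right, h⟩
  · conv_lhs => rw [← hunion]
    exact rank_union_le
  · refine Set.sdiff_subset.ssubset_of_ne fun h => ?_
    obtain ⟨e, he⟩ := hA
    exact (h.symm ▸ hAF he : e ∈ F \ A).2 he

/-- In an indecomposable set one can exchange an element of `A` for an element outside `A` between
some two bases. -/
theorem Indecomposable.exists_exchange {F : Set α} (hF : Indecomposable M F) (hAF : A ⊆ F)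
    (hA : A.Nonempty) (hne : A ≠ F) :
    ∃ (B B' : Set α) (e f : α), M.Indep B ∧ M.Indep B' ∧ B ⊆ F ∧ B' ⊆ F ∧ B.ncard = rank M F ∧
      B'.ncard = rank M F ∧ e ∈ A ∧ f ∈ F \ A ∧ e ∉ B ∧ f ∉ B' ∧ insert e B = insert f B' := by
  have hlt := hF.rank_lt hAF hA hne
  obtain ⟨J, hJA, hJ, hJc⟩ := exists_basis (M := M) (F \ A)
  obtain ⟨B, hJB, hBF, hB, hBc⟩ := exists_basis_extending hJ (hJA.trans Set.sdiff_subset)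
  obtain ⟨K, hKA, hK, hKc⟩ := exists_basis (M := M) A
  have hBfin := finite_of_indep hB
  have hsplit : (B ∩ A).ncard + (B \ A).ncard = B.ncard :=
    Set.ncard_inter_add_ncard_sdiff_eq_ncard B A hBfin
  have hJle : J.ncard ≤ (B \ A).ncard :=
    Set.ncard_le_ncard (fun x hx => ⟨hJB hx, (hJA hx).2⟩) (hBfin.subset Set.sdiff_subset)
  have hBA : M.Indep (B ∩ A) := hB.subset Set.inter_subset_left
  -- As `B` contains a basis of `F \ A`, it has at most r(F) - r(F \ A) < r(A) elements in `A`, so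
  -- `B ∩ A` can be augmented from `K`.
  have hcard : (B ∩ A).encard < K.encard := by
    rw [← (finite_of_indep hBA).cast_ncard_eq, ← (finite_of_indep hK).cast_ncard_eq]
    exact_mod_cast (by omega : (B ∩ A).ncard < K.ncard)
  obtain ⟨e, ⟨heK, heBA⟩, hins⟩ := hBA.exists_insert_of_encard_lt hK hcard
  have heA : e ∈ A := hKA heK
  have heB : e ∉ B := fun h => heBA ⟨h, heA⟩
  -- `B'` omits exactly one element `f` of `insert e B`. It contains every element of that set lying
  -- in `A`, so `f ∉ A`.
  obtain ⟨B', hsub, hB'sub, hB', hB'c⟩ := exists_basis_extending hins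
    (Set.insert_subset_insert (Set.inter_subset_left : B ∩ A ⊆ B))
  have hinsF : insert e B ⊆ F := Set.insert_subset (hAF heA) hBF
  have hrank : rank M (insert e B) = rank M F := by
    refine le_antisymm (rank_mono hinsF) ?_
    rw [← hBc]
    exact ncard_le_rank hB (Set.subset_insert e B)
  rw [hrank] at hB'c
  have hins_card : (insert e B).ncard = B.ncard + 1 := Set.ncard_insert_of_notMem heB hBfin
  have hdiff : (insert e B \ B').ncard = 1 := by
    have := Set.ncard_sdiff_add_ncard_of_subset hB'sub (hBfin.insert e)
    omega
  obtain ⟨f, hf⟩ := Set.ncard_eq_one.1 hdiff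
  have hfmem : f ∈ insert e B \ B' := hf ▸ Set.mem_singleton f
  have hfA : f ∉ A := fun h => by
    rcases hfmem.1 with rfl | hfB
    · exact hfmem.2 (hsub (Set.mem_insert _ _))
    · exact hfmem.2 (hsub (Set.mem_insert_of_mem _ ⟨hfB, h⟩))
  refine ⟨B, B', e, f, hB, hB', hBF, hB'sub.trans hinsF, hBc, hB'c, heA, ⟨hinsF hfmem.1, hfA⟩, heB,
    hfmem.2, ?_⟩
  rw [← Set.sdiff_union_of_subset hB'sub, hf, Set.singleton_union]

end Rank

/-! ### Indicator vectors and their dot products. -/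

section IndicatorVectors

variable {α : Type*} {M : Matroid α} {A B I : Set α}

theorem indicatorVector_apply_of_mem {e : M.E} (h : (e : α) ∈ A) : indicatorVector M A e = 1 :=
  if_pos h

theorem indicatorVector_apply_of_notMem {e : M.E} (h : (e : α) ∉ A) :
    indicatorVector M A e = 0 :=
  if_neg h

theorem indicatorVector_nonneg (e : M.E) : 0 ≤ indicatorVector M A e := by
  unfold indicatorVector; split_ifs <;> norm_num

theorem indicatorVector_empty : indicatorVector M ∅ = 0 := by
  ext e; simp [indicatorVector]

theorem indicatorVector_singleton_of_ne {e f : M.E} (h : f ≠ e) :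
    indicatorVector M {(e : α)} f = 0 :=
  indicatorVector_apply_of_notMem (A := {(e : α)}) fun hf => h (Subtype.ext hf)

theorem indicatorVector_singleton [DecidableEq M.E] (e : M.E) :
    indicatorVector M {(e : α)} = Pi.single e 1 := by
  ext f
  by_cases h : f = e
  · subst h
    rw [indicatorVector_apply_of_mem (Set.mem_singleton _), Pi.single_eq_same]
  · rw [indicatorVector_singleton_of_ne h, Pi.single_eq_of_ne h]

theorem indicatorVector_union (h : Disjoint A B) :
    indicatorVector M (A ∪ B) = indicatorVector M A + indicatorVector M B := by
  ext e
  have : (e : α) ∈ A → (e : α) ∉ B := fun hA hB => Set.disjoint_left.1 h hA hB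
  by_cases hA : (e : α) ∈ A <;> by_cases hB : (e : α) ∈ B <;> simp_all [indicatorVector]

theorem indicatorVector_insert {e : α} (h : e ∉ A) :
    indicatorVector M (insert e A) = indicatorVector M {e} + indicatorVector M A := by
  rw [Set.insert_eq, indicatorVector_union (Set.disjoint_singleton_left.2 h)]

variable [Fintype M.E]

theorem indicatorVector_singleton_dotProduct (e : M.E) (x : M.E → ℝ) :
    indicatorVector M {(e : α)} ⬝ᵥ x = x e := by
  classical
  rw [indicatorVector_singleton, single_one_dotProduct]

theorem dotProduct_indicatorVector_singleton (e : M.E) (x : M.E → ℝ) :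
    x ⬝ᵥ indicatorVector M {(e : α)} = x e := by
  rw [dotProduct_comm, indicatorVector_singleton_dotProduct]

theorem indicatorVector_dotProduct_indicatorVector (hI : I ⊆ M.E) :
    indicatorVector M A ⬝ᵥ indicatorVector M I = ((I ∩ A).ncard : ℝ) := by
  classical
  have h : I ∩ A = Subtype.val '' {e : M.E | (e : α) ∈ I ∩ A} := by
    ext e
    constructor
    · exact fun he => ⟨⟨e, hI he.1⟩, he, rfl⟩
    · rintro ⟨f, hf, rfl⟩; exact hf
  rw [h, Set.ncard_image_of_injective _ Subtype.val_injective, Set.ncard_eq_toFinset_card',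
    Set.toFinset_ofPred, dotProduct, Finset.card_filter]
  push_cast
  refine Finset.sum_congr rfl fun e _ => ?_
  by_cases hA : (e : α) ∈ A <;> by_cases hI : (e : α) ∈ I <;> simp [indicatorVector, hA, hI]

theorem indicatorVector_dotProduct_mono {x : M.E → ℝ} (hx : ∀ e, 0 ≤ x e) (h : A ⊆ B) :
    indicatorVector M A ⬝ᵥ x ≤ indicatorVector M B ⬝ᵥ x := by
  refine Finset.sum_le_sum fun e _ => mul_le_mul_of_nonneg_right ?_ (hx e)
  by_cases hA : (e : α) ∈ A
  · rw [indicatorVector_apply_of_mem hA, indicatorVector_apply_of_mem (h hA)]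
  · rw [indicatorVector_apply_of_notMem hA]; exact indicatorVector_nonneg e

end IndicatorVectors

/-! ### Edmonds' theorem and the reduction to indecomposable flats. -/

section Edmonds

variable {α : Type*} {M : Matroid α}

theorem indicatorVector_mem_indepPolytope {I : Set α} (hI : M.Indep I) :
    indicatorVector M I ∈ indepPolytope M :=
  subset_convexHull ℝ _ ⟨I, hI, rfl⟩

variable [Fintype M.E]

theorem finite_of_fintype_ground : M.Finite := ⟨Set.toFinite M.E⟩

theorem dotProduct_le_of_mem_indepPolytope {a : M.E → ℝ} {b : ℝ}
    (h : ∀ I, M.Indep I → a ⬝ᵥ indicatorVector M I ≤ b) {x : M.E → ℝ}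
    (hx : x ∈ indepPolytope M) : a ⬝ᵥ x ≤ b := by
  have hconv : Convex ℝ {y : M.E → ℝ | a ⬝ᵥ y ≤ b} := by
    refine convex_halfSpace_le (f := fun y => a ⬝ᵥ y) ⟨fun x y => ?_, fun c x => ?_⟩ b
    · exact dotProduct_add a x y
    · exact dotProduct_smul c a x
  refine convexHull_min ?_ hconv hx
  rintro _ ⟨I, hI, rfl⟩
  exact h I hI

theorem nonneg_of_mem_indepPolytope {x : M.E → ℝ} (hx : x ∈ indepPolytope M) (e : M.E) :
    0 ≤ x e := by
  have := dotProduct_le_of_mem_indepPolytope (a := -indicatorVector M {(e : α)}) (b := 0)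
    (fun I _ => by
      rw [neg_dotProduct, indicatorVector_singleton_dotProduct]
      exact neg_nonpos.2 (indicatorVector_nonneg e)) hx
  rwa [neg_dotProduct, indicatorVector_singleton_dotProduct, neg_nonpos] at this

theorem le_rank_of_mem_indepPolytope {x : M.E → ℝ} (hx : x ∈ indepPolytope M) (A : Set α) :
    indicatorVector M A ⬝ᵥ x ≤ rank M A := by
  have := finite_of_fintype_ground (M := M)
  refine dotProduct_le_of_mem_indepPolytope (fun I hI => ?_) hx
  rw [indicatorVector_dotProduct_indicatorVector hI.subset_ground]
  exact_mod_cast ncard_le_rank (hI.subset Set.inter_subset_left) Set.inter_subset_right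

/-- A nonnegative weight is at least as large on some independent subset of its support as on a
given vector satisfying all rank inequalities. -/
theorem exists_indep_dotProduct_le {x : M.E → ℝ}
    (hx : ∀ A ⊆ M.E, indicatorVector M A ⬝ᵥ x ≤ rank M A) (w : M.E → ℝ)
    (hw : ∀ e, 0 ≤ w e) :
    ∃ I, M.Indep I ∧ (∀ e : M.E, (e : α) ∈ I → w e ≠ 0) ∧ w ⬝ᵥ x ≤ w ⬝ᵥ indicatorVector M I := by
  classical
  have := finite_of_fintype_ground (M := M)
  induction hn : (Finset.univ.filter fun e => w e ≠ 0).card using Nat.strong_induction_on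
    generalizing w with
  | _ n ih =>
  subst hn
  rcases (Finset.univ.filter fun e => w e ≠ 0).eq_empty_or_nonempty with h0 | hne
  · have hw0 : w = 0 := by
      ext e
      by_contra h
      exact Finset.notMem_empty e (h0 ▸ Finset.mem_filter.2 ⟨Finset.mem_univ e, h⟩)
    exact ⟨∅, M.empty_indep, by simp, by simp [hw0]⟩
  · obtain ⟨e₀, he₀, hmin⟩ := Finset.exists_min_image _ w hne
    have he₀' : w e₀ ≠ 0 := (Finset.mem_filter.1 he₀).2
    have hmin' : ∀ e, w e ≠ 0 → w e₀ ≤ w e := fun e he =>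
      hmin e (Finset.mem_filter.2 ⟨Finset.mem_univ e, he⟩)
    -- Greedy peeling: subtracting the least nonzero weight on the support `S` gives `w'` with
    -- smaller support.
    let S : Set α := Subtype.val '' {e : M.E | w e ≠ 0}
    have hS : ∀ e : M.E, (e : α) ∈ S ↔ w e ≠ 0 := fun e =>
      Subtype.val_injective.mem_set_image
    let w' : M.E → ℝ := fun e => if w e = 0 then 0 else w e - w e₀
    have hw' : ∀ e, 0 ≤ w' e := fun e => by
      by_cases h : w e = 0
      · simp [w', h]
      · simpa [w', h] using hmin' e h
    have hsupp : ∀ e, w' e ≠ 0 → w e ≠ 0 := fun e h h' => h (by simp [w', h'])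
    have hdecomp : w = w' + w e₀ • indicatorVector M S := by
      ext e
      by_cases h : w e = 0
      · simp [w', h, indicatorVector, hS]
      · simp [w', h, indicatorVector, hS]
    have hcard : (Finset.univ.filter fun e => w' e ≠ 0).card <
        (Finset.univ.filter fun e => w e ≠ 0).card := by
      refine Finset.card_lt_card (Finset.ssubset_iff_of_subset ?_ |>.2 ⟨e₀, he₀, ?_⟩)
      · exact Finset.monotone_filter_right _ fun e _ => hsupp e
      · simp [w', he₀']
    obtain ⟨I', hI', hI'supp, hle⟩ := ih _ hcard w' hw' rfl
    have hI'S : I' ⊆ S := fun e he =>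
      (hS ⟨e, hI'.subset_ground he⟩).2 (hsupp _ (hI'supp ⟨e, hI'.subset_ground he⟩ he))
    -- Enlarging `I'` to a basis of `S` cannot lower the `w'` part and makes the `S` part attain its
    -- maximum r(S).
    obtain ⟨I, hI'I, hIS, hI, hIc⟩ := exists_basis_extending hI' hI'S
    refine ⟨I, hI, fun e he => (hS e).1 (hIS he), ?_⟩
    have h1 : w' ⬝ᵥ indicatorVector M I' ≤ w' ⬝ᵥ indicatorVector M I := by
      rw [dotProduct_comm w', dotProduct_comm w']
      exact indicatorVector_dotProduct_mono hw' hI'I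
    have h2 : indicatorVector M S ⬝ᵥ indicatorVector M I = rank M S := by
      rw [indicatorVector_dotProduct_indicatorVector hI.subset_ground,
        Set.inter_eq_left.2 hIS, hIc]
    have h3 := mul_le_mul_of_nonneg_left (hx S (Subtype.coe_image_subset _ _)) (hw e₀)
    rw [hdecomp]
    simp only [add_dotProduct, smul_dotProduct, smul_eq_mul, h2]
    linarith

theorem isClosed_indepPolytope : IsClosed (indepPolytope M) := by
  have hfin : {v | ∃ I : Set α, M.Indep I ∧ v = indicatorVector M I}.Finite := by
    refine ((Set.toFinite M.E).finite_subsets.image (indicatorVector M)).subset ?_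
    rintro _ ⟨I, hI, rfl⟩
    exact ⟨I, hI.subset_ground, rfl⟩
  exact hfin.isClosed_convexHull (𝕜 := ℝ)

/-- Edmonds' description of the independence polytope by all rank inequalities. -/
theorem mem_indepPolytope_iff {x : M.E → ℝ} :
    x ∈ indepPolytope M ↔
      (∀ e, 0 ≤ x e) ∧ ∀ A ⊆ M.E, indicatorVector M A ⬝ᵥ x ≤ rank M A := by
  classical
  refine ⟨fun h => ⟨nonneg_of_mem_indepPolytope h, fun A _ => le_rank_of_mem_indepPolytope h A⟩, ?_⟩
  rintro ⟨hx0, hx⟩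
  by_contra hxP
  obtain ⟨f, u, hfu, hux⟩ :=
    geometric_hahn_banach_closed_point (convex_convexHull ℝ _) isClosed_indepPolytope hxP
  have hf : ∀ y, f y = (fun i => f (Pi.single i 1)) ⬝ᵥ y := fun y =>
    dual_apply_eq_dotProduct f.toLinearMap y
  generalize (fun i => f (Pi.single i 1)) = w at hf
  -- Passing to the positive part of `w` does not decrease the value at `x ≥ 0`, and changes nothing
  -- on `I`, which lies in the support of that part.
  obtain ⟨I, hI, hsupp, hle⟩ :=
    exists_indep_dotProduct_le hx (fun e => max (w e) 0) fun e => le_max_right _ _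
  have h1 := hfu _ (indicatorVector_mem_indepPolytope hI)
  rw [hf] at h1 hux
  have h2 : w ⬝ᵥ x ≤ (fun e => max (w e) 0) ⬝ᵥ x :=
    Finset.sum_le_sum fun e _ => mul_le_mul_of_nonneg_right (le_max_left _ _) (hx0 e)
  have h3 : (fun e => max (w e) 0) ⬝ᵥ indicatorVector M I = w ⬝ᵥ indicatorVector M I := by
    refine Finset.sum_congr rfl fun e _ => ?_
    by_cases he : (e : α) ∈ I
    · have := hsupp e he
      have hpos : 0 ≤ w e := by
        by_contra h
        exact this (max_eq_right (not_le.1 h).le)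
      simp only [max_eq_left hpos]
    · simp [indicatorVector_apply_of_notMem he]
  linarith

/-- The rank inequalities of the nonempty indecomposable flats imply all rank inequalities. -/
theorem le_rank_of_forall_indecomposable_flat [M.Loopless] {x : M.E → ℝ} (hx0 : ∀ e, 0 ≤ x e)
    (hx : ∀ F : Set α, F.Nonempty → M.IsFlat F → Indecomposable M F →
      indicatorVector M F ⬝ᵥ x ≤ rank M F) (A : Set α) (hA : A ⊆ M.E) :
    indicatorVector M A ⬝ᵥ x ≤ rank M A := by
  have := finite_of_fintype_ground (M := M)
  -- The pieces of a decomposed flat need not be flats, so the induction runs over all subsets.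
  -- Looplessness gives both pieces positive rank, hence each has smaller rank.
  induction hn : rank M A using Nat.strong_induction_on generalizing A with
  | _ n ih =>
  subst hn
  rcases A.eq_empty_or_nonempty with rfl | hne
  · simp [indicatorVector_empty]
  rw [← rank_closure (A := A)]
  refine (indicatorVector_dotProduct_mono hx0 (M.subset_closure A hA)).trans ?_
  by_cases hdec : Indecomposable M (M.closure A)
  · exact hx _ (hne.mono (M.subset_closure A hA)) (M.isFlat_closure A) hdec
  · obtain ⟨A₁, A₂, h1, h2, hu, hd, hr⟩ := not_not.1 hdec
    have hE : M.closure A ⊆ M.E := M.closure_subset_ground A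
    have hA₁ : A₁.Nonempty := Set.nonempty_iff_ne_empty.2 fun h => by
      rw [h, Set.empty_union] at hu; exact h2.ne hu
    have hA₂ : A₂.Nonempty := Set.nonempty_iff_ne_empty.2 fun h => by
      rw [h, Set.union_empty] at hu; exact h1.ne hu
    have hp1 := rank_pos (M := M) (h1.subset.trans hE) hA₁
    have hp2 := rank_pos (M := M) (h2.subset.trans hE) hA₂
    have hcl := rank_closure (M := M) (A := A)
    have i1 := ih (rank M A₁) (by omega) A₁ (h1.subset.trans hE) rfl
    have i2 := ih (rank M A₂) (by omega) A₂ (h2.subset.trans hE) rfl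
    rw [hr, ← hu, indicatorVector_union hd, add_dotProduct]
    push_cast
    linarith

end Edmonds

variable {α : Type*} {M : Matroid α}

/-! ### Tight vertices, facets and minimality of the system. -/

section System

theorem indep_singleton_coe [M.Loopless] (e : M.E) : M.Indep {(e : α)} :=
  Matroid.indep_singleton.2 (M.isNonloop_of_loopless e.2)

/-- Of two distinct nonempty indecomposable flats, one does not meet every basis of the other in a
basis of itself. -/
theorem exists_basis_inter_ncard_lt [M.Finite] {F G : Set α} (hF : Indecomposable M F)
    (hG : M.IsFlat G) (hFE : M.IsFlat F) (hGne : G.Nonempty) (hGF : G ≠ F) :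
    ∃ I ⊆ F, M.Indep I ∧ I.ncard = rank M F ∧ (I ∩ G).ncard < rank M G := by
  by_contra! hcon
  -- An element of `G` outside `F` could be added to `I ∩ G`, giving more than r(G) independent
  -- elements in `G`.
  have hGsub : G ⊆ F := by
    obtain ⟨I, hIF, hI, hIc⟩ := exists_basis (M := M) F
    have hle := hcon I hIF hI hIc
    intro e he
    by_contra heF
    have hi := indep_insert_of_notMem_flat hFE hI hIF (hG.subset_ground he) heF
    have hi' : M.Indep (insert e (I ∩ G)) :=
      hi.subset (Set.insert_subset_insert Set.inter_subset_left)
    have h1 := ncard_le_rank hi' (Set.insert_subset he Set.inter_subset_right)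
    rw [Set.ncard_insert_of_notMem (fun h => heF (hIF h.1))
      ((finite_of_indep hI).subset Set.inter_subset_left)] at h1
    omega
  have hlt := hF.rank_lt hGsub hGne hGF
  -- A basis of `F` grown from a basis of `F \ G` has at most r(F) - r(F \ G) < r(G) elements in
  -- `G`.
  obtain ⟨J, hJ, hJi, hJc⟩ := exists_basis (M := M) (F \ G)
  obtain ⟨I, hJI, hIF, hI, hIc⟩ := exists_basis_extending hJi (hJ.trans Set.sdiff_subset)
  have hfin := finite_of_indep hI
  have h1 := hcon I hIF hI hIc
  have h2 : J.ncard ≤ (I \ G).ncard :=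
    Set.ncard_le_ncard (fun x hx => ⟨hJI hx, (hJ hx).2⟩) (hfin.subset Set.sdiff_subset)
  have h3 := Set.ncard_inter_add_ncard_sdiff_eq_ncard I G hfin
  omega

theorem nonempty_indepPolytope : (indepPolytope M).Nonempty :=
  ⟨_, indicatorVector_mem_indepPolytope M.empty_indep⟩

/-- The outer normal vector of one inequality of the system. -/
noncomputable def normal (M : Matroid α) : IneqIndex M → M.E → ℝ
  | .inl e => -indicatorVector M {(e : α)}
  | .inr F => indicatorVector M F.1

/-- The right hand side of one inequality of the system. -/
noncomputable def bound (M : Matroid α) : IneqIndex M → ℝ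
  | .inl _ => 0
  | .inr F => rank M F.1

variable [Fintype M.E]

theorem normal_inl_dotProduct (e : M.E) (x : M.E → ℝ) : normal M (.inl e) ⬝ᵥ x = -x e := by
  rw [normal, neg_dotProduct, indicatorVector_singleton_dotProduct]

theorem normal_inr_dotProduct_indicatorVector
    (F : {F : Set α // F.Nonempty ∧ M.IsFlat F ∧ Indecomposable M F}) {I : Set α}
    (hI : M.Indep I) :
    normal M (.inr F) ⬝ᵥ indicatorVector M I = ((I ∩ F.1).ncard : ℝ) :=
  indicatorVector_dotProduct_indicatorVector hI.subset_ground

theorem smallSide_inr (F : {F : Set α // F.Nonempty ∧ M.IsFlat F ∧ Indecomposable M F})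
    (x : M.E → ℝ) : smallSide M x (.inr F) = indicatorVector M F.1 ⬝ᵥ x := by
  simp only [smallSide, dotProduct, indicatorVector, ite_mul, one_mul, zero_mul, Finset.sum_filter]

theorem mem_halfSpace_iff {i : IneqIndex M} {x : M.E → ℝ} :
    x ∈ halfSpace M i ↔ normal M i ⬝ᵥ x ≤ bound M i := by
  cases i with
  | inl e =>
    rw [normal_inl_dotProduct]
    exact (neg_nonpos (a := x e)).symm
  | inr F =>
    change smallSide M x (.inr F) ≤ _ ↔ _
    rw [smallSide_inr]
    rfl

theorem mem_boundingHyperplane_iff {i : IneqIndex M} {x : M.E → ℝ} :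
    x ∈ boundingHyperplane M i ↔ normal M i ⬝ᵥ x = bound M i := by
  cases i with
  | inl e =>
    rw [normal_inl_dotProduct]
    exact eq_comm.trans (neg_eq_zero (a := x e)).symm
  | inr F =>
    change smallSide M x (.inr F) = _ ↔ _
    rw [smallSide_inr]
    rfl

theorem finite_ineqIndex : Finite (IneqIndex M) := by
  have : Finite {F : Set α // F.Nonempty ∧ M.IsFlat F ∧ Indecomposable M F} :=
    ((Set.toFinite M.E).finite_subsets.subset fun F hF => hF.2.1.subset_ground).to_subtype
  infer_instance

theorem mem_indepPolytope_iff_forall_normal [M.Loopless] {x : M.E → ℝ} :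
    x ∈ indepPolytope M ↔ ∀ i, normal M i ⬝ᵥ x ≤ bound M i := by
  constructor
  · rintro hx (e | F)
    · rw [normal_inl_dotProduct]
      exact neg_nonpos.2 (nonneg_of_mem_indepPolytope hx e)
    · exact le_rank_of_mem_indepPolytope hx F.1
  · intro h
    have h0 : ∀ e, 0 ≤ x e := fun e => by
      have := h (.inl e)
      rw [normal_inl_dotProduct] at this
      exact neg_nonpos.1 this
    exact mem_indepPolytope_iff.2 ⟨h0, le_rank_of_forall_indecomposable_flat h0
      fun F h1 h2 h3 => h (.inr ⟨F, h1, h2, h3⟩)⟩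

theorem indepPolytope_eq_iInter [M.Loopless] :
    indepPolytope M = ⋂ i, halfSpace M i := by
  ext x
  simp only [Set.mem_iInter, mem_halfSpace_iff, mem_indepPolytope_iff_forall_normal]

theorem exists_indep_lt_bound [M.Loopless] (i : IneqIndex M) :
    ∃ I, M.Indep I ∧ normal M i ⬝ᵥ indicatorVector M I < bound M i := by
  have := finite_of_fintype_ground (M := M)
  cases i with
  | inl e =>
    refine ⟨{(e : α)}, indep_singleton_coe e, ?_⟩
    rw [normal_inl_dotProduct, indicatorVector_apply_of_mem (Set.mem_singleton _)]
    exact neg_one_lt_zero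
  | inr F =>
    refine ⟨∅, M.empty_indep, ?_⟩
    rw [indicatorVector_empty, dotProduct_zero]
    exact Nat.cast_pos.2 (rank_pos F.2.2.1.subset_ground F.2.1)

theorem exists_indep_eq_bound (i : IneqIndex M) :
    ∃ I, M.Indep I ∧ normal M i ⬝ᵥ indicatorVector M I = bound M i := by
  have := finite_of_fintype_ground (M := M)
  cases i with
  | inl e =>
    refine ⟨∅, M.empty_indep, ?_⟩
    rw [indicatorVector_empty, dotProduct_zero]
    rfl
  | inr F =>
    obtain ⟨I, hIF, hI, hIc⟩ := exists_basis (M := M) F.1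
    refine ⟨I, hI, ?_⟩
    rw [normal_inr_dotProduct_indicatorVector F hI, Set.inter_eq_left.2 hIF, hIc]
    rfl

theorem exists_indep_eq_bound_lt_bound [M.Loopless] (i j : IneqIndex M) (hji : j ≠ i) :
    ∃ I, M.Indep I ∧ normal M i ⬝ᵥ indicatorVector M I = bound M i ∧
      normal M j ⬝ᵥ indicatorVector M I < bound M j := by
  have := finite_of_fintype_ground (M := M)
  rcases i with e | F
  · rcases j with f | G
    · have hfe : f ≠ e := fun h => hji (h ▸ rfl)
      refine ⟨{(f : α)}, indep_singleton_coe f, ?_, ?_⟩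
      · rw [normal_inl_dotProduct,
          indicatorVector_singleton_of_ne (Ne.symm hfe), neg_zero]
        rfl
      · rw [normal_inl_dotProduct, indicatorVector_apply_of_mem (Set.mem_singleton _)]
        exact neg_one_lt_zero
    · refine ⟨∅, M.empty_indep, ?_, ?_⟩
      · rw [indicatorVector_empty, dotProduct_zero]
        rfl
      · rw [indicatorVector_empty, dotProduct_zero]
        exact Nat.cast_pos.2 (rank_pos G.2.2.1.subset_ground G.2.1)
  · rcases j with f | G
    · suffices h : ∃ I, M.Indep I ∧ (I ∩ F.1).ncard = rank M F.1 ∧ (f : α) ∈ I by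
        obtain ⟨I, hI, hIc, hfI⟩ := h
        refine ⟨I, hI, ?_, ?_⟩
        · rw [normal_inr_dotProduct_indicatorVector F hI, hIc]
          rfl
        · rw [normal_inl_dotProduct, indicatorVector_apply_of_mem hfI]
          exact neg_one_lt_zero
      by_cases hfF : (f : α) ∈ F.1
      · obtain ⟨I, hfI, hIF, hI, hIc⟩ := exists_basis_extending (indep_singleton_coe f)
          (Set.singleton_subset_iff.2 hfF)
        exact ⟨I, hI, by rw [Set.inter_eq_left.2 hIF, hIc], hfI rfl⟩
      · obtain ⟨I, hIF, hI, hIc⟩ := exists_basis (M := M) F.1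
        refine ⟨_, indep_insert_of_notMem_flat F.2.2.1 hI hIF f.2 hfF, ?_, Set.mem_insert _ _⟩
        rw [Set.insert_inter_of_notMem hfF, Set.inter_eq_left.2 hIF, hIc]
    · have hGF : G.1 ≠ F.1 := fun h => hji (congrArg Sum.inr (Subtype.ext h))
      obtain ⟨I, hIF, hI, hIc, hlt⟩ :=
        exists_basis_inter_ncard_lt F.2.2.2 G.2.2.1 F.2.2.1 G.2.1 hGF
      refine ⟨I, hI, ?_, ?_⟩
      · rw [normal_inr_dotProduct_indicatorVector F hI, Set.inter_eq_left.2 hIF, hIc]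
        rfl
      · rw [normal_inr_dotProduct_indicatorVector G hI]
        exact Nat.cast_lt.2 hlt

theorem normal_ne_zero [M.Loopless] (i : IneqIndex M) : normal M i ≠ 0 := by
  intro h
  obtain ⟨I, -, hI⟩ := exists_indep_lt_bound i
  obtain ⟨J, -, hJ⟩ := exists_indep_eq_bound i
  rw [h, zero_dotProduct] at hI hJ
  exact hI.ne hJ

/-- A linear functional that is constant on the vertices on a bounding hyperplane is a multiple of
its normal vector. -/
theorem eq_smul_normal_of_const [M.Loopless] (i : IneqIndex M) (w : M.E → ℝ) (c : ℝ)
    (h : ∀ I, M.Indep I → normal M i ⬝ᵥ indicatorVector M I = bound M i →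
      w ⬝ᵥ indicatorVector M I = c) : ∃ t : ℝ, w = t • normal M i := by
  have := finite_of_fintype_ground (M := M)
  rcases i with e | F
  · have hc : 0 = c := by
      rw [← h ∅ M.empty_indep, indicatorVector_empty, dotProduct_zero]
      rw [indicatorVector_empty, dotProduct_zero]
      rfl
    refine ⟨-w e, funext fun f => ?_⟩
    change w f = -w e * -indicatorVector M {(e : α)} f
    by_cases hfe : f = e
    · subst hfe
      rw [indicatorVector_apply_of_mem (Set.mem_singleton _)]
      ring
    · have hf := h {(f : α)} (indep_singleton_coe f) (by
        rw [normal_inl_dotProduct,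
          indicatorVector_singleton_of_ne (Ne.symm hfe), neg_zero]
        rfl)
      rw [dotProduct_indicatorVector_singleton] at hf
      rw [indicatorVector_singleton_of_ne hfe, hf, ← hc]
      ring
  · have hbasis : ∀ I, M.Indep I → (I ∩ F.1).ncard = rank M F.1 →
        w ⬝ᵥ indicatorVector M I = c := fun I hI hIc => h I hI (by
      rw [normal_inr_dotProduct_indicatorVector F hI, hIc]
      rfl)
    have hsub : ∀ I ⊆ F.1, M.Indep I → I.ncard = rank M F.1 →
        w ⬝ᵥ indicatorVector M I = c := fun I hIF hI hIc =>
      hbasis I hI (by rw [Set.inter_eq_left.2 hIF, hIc])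
    obtain ⟨e₀, he₀⟩ := F.2.1
    have hFE := F.2.2.1.subset_ground
    refine ⟨w ⟨e₀, hFE he₀⟩, funext fun f => ?_⟩
    change w f = w ⟨e₀, hFE he₀⟩ * indicatorVector M F.1 f
    by_cases hfF : (f : α) ∈ F.1
    · rw [indicatorVector_apply_of_mem hfF, mul_one]
      by_contra hne
      -- If `w` is not constant on `F`, its level set through `e₀` is a proper nonempty subset. The
      -- exchange then yields `w e = w g` with `e` inside and `g` outside, a contradiction.
      let A : Set α := Subtype.val '' {e : M.E | (e : α) ∈ F.1 ∧ w e = w ⟨e₀, hFE he₀⟩}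
      have hA : ∀ e : M.E, (e : α) ∈ A ↔ (e : α) ∈ F.1 ∧ w e = w ⟨e₀, hFE he₀⟩ := fun e =>
        Subtype.val_injective.mem_set_image
      have hAF : A ⊆ F.1 := by
        rintro _ ⟨e, he, rfl⟩
        exact he.1
      obtain ⟨B, B', e, g, hB, hB', hBF, hB'F, hBc, hB'c, heA, hg, heB, hgB', heq⟩ :=
        F.2.2.2.exists_exchange hAF ⟨e₀, (hA ⟨e₀, hFE he₀⟩).2 ⟨he₀, rfl⟩⟩
          (fun hAF => hne ((hA f).1 (hAF ▸ hfF)).2)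
      have hv := congrArg (fun S => w ⬝ᵥ indicatorVector M S) heq
      simp only [indicatorVector_insert heB, indicatorVector_insert hgB', dotProduct_add,
        hsub B hBF hB hBc, hsub B' hB'F hB' hB'c, add_left_inj] at hv
      have heE : e ∈ M.E := hFE (hAF heA)
      have hgE : g ∈ M.E := hFE hg.1
      have h1 := dotProduct_indicatorVector_singleton ⟨e, heE⟩ w
      have h2 := dotProduct_indicatorVector_singleton ⟨g, hgE⟩ w
      simp only at h1 h2
      rw [h1, h2] at hv
      refine hg.2 ((hA ⟨g, hgE⟩).2 ⟨hg.1, ?_⟩)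
      rw [← hv]
      exact ((hA ⟨e, heE⟩).1 heA).2
    · obtain ⟨I, hIF, hI, hIc⟩ := exists_basis (M := M) F.1
      -- Both `I` and `insert f I` are tight for `F`, so `w f = 0`.
      have hins := hbasis _ (indep_insert_of_notMem_flat F.2.2.1 hI hIF f.2 hfF) (by
        rw [Set.insert_inter_of_notMem hfF, Set.inter_eq_left.2 hIF, hIc])
      rw [indicatorVector_insert fun hf => hfF (hIF hf), dotProduct_add,
        dotProduct_indicatorVector_singleton, hsub I hIF hI hIc] at hins
      rw [indicatorVector_apply_of_notMem hfF, mul_zero]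
      linarith

theorem vectorSpan_indepPolytope [M.Loopless] : vectorSpan ℝ (indepPolytope M) = ⊤ := by
  refine vectorSpan_eq_top nonempty_indepPolytope fun w c h => funext fun e => ?_
  have h0 := h _ (indicatorVector_mem_indepPolytope M.empty_indep)
  have h1 := h _ (indicatorVector_mem_indepPolytope (indep_singleton_coe e))
  rw [indicatorVector_empty, dotProduct_zero] at h0
  rw [dotProduct_indicatorVector_singleton, ← h0] at h1
  exact h1

theorem isFacet_inter_boundingHyperplane [M.Loopless] (i : IneqIndex M) :
    IsFacet (indepPolytope M) (indepPolytope M ∩ boundingHyperplane M i) := by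
  obtain ⟨I, hI, hIb⟩ := exists_indep_eq_bound i
  have hle : ∀ x ∈ indepPolytope M, normal M i ⬝ᵥ x ≤ bound M i := fun x hx =>
    mem_indepPolytope_iff_forall_normal.1 hx i
  have hmem : indicatorVector M I ∈ indepPolytope M ∩ boundingHyperplane M i :=
    ⟨indicatorVector_mem_indepPolytope hI, mem_boundingHyperplane_iff.2 hIb⟩
  refine ⟨⟨_, hmem⟩, fun _ => ?_, ?_⟩
  · let l : (M.E → ℝ) →L[ℝ] ℝ := LinearMap.toContinuousLinearMap (dotProductBilin ℝ ℝ (normal M i))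
    have hl : ∀ x, l x = normal M i ⬝ᵥ x := fun x => rfl
    refine ⟨l, Set.ext fun x => ?_⟩
    simp only [Set.mem_inter_iff, mem_boundingHyperplane_iff, Set.mem_ofPred_eq, hl]
    refine and_congr_right fun hx => ⟨fun h y hy => h ▸ hle y hy, fun h => ?_⟩
    exact le_antisymm (hle x hx) (hIb ▸ h _ hmem.1)
  · rw [affineDim_add_one ⟨_, hmem⟩ (normal_ne_zero i)
      (fun x hx => mem_boundingHyperplane_iff.1 hx.2) fun w c h => ?_]
    · rw [affineDim, vectorSpan_indepPolytope, finrank_top, Module.finrank_fintype_fun_eq_card]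
    · exact eq_smul_normal_of_const i w c fun J hJ hJb =>
        h _ ⟨indicatorVector_mem_indepPolytope hJ, mem_boundingHyperplane_iff.2 hJb⟩

theorem minimal_system [M.Loopless] :
    Minimal (fun J : Set (IneqIndex M) => indepPolytope M = ⋂ i ∈ J, halfSpace M i) Set.univ := by
  have := finite_ineqIndex (M := M)
  refine ⟨by simpa using indepPolytope_eq_iInter, fun J hJ _ i _ => ?_⟩
  by_contra hi
  have hP : ∀ I, M.Indep I → ∀ j, normal M j ⬝ᵥ indicatorVector M I ≤ bound M j := fun I hI =>
    mem_indepPolytope_iff_forall_normal.1 (indicatorVector_mem_indepPolytope hI)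
  -- If `i` were omitted from `J`, a point violating only inequality `i` would satisfy the subsystem
  -- yet lie outside the polytope.
  obtain ⟨x, hxi, hx⟩ := exists_violating_only (normal M) (bound M) i
    (by
      obtain ⟨I, hI, h⟩ := exists_indep_lt_bound i
      exact ⟨_, hP I hI, h⟩)
    (by
      obtain ⟨I, hI, h⟩ := exists_indep_eq_bound i
      exact ⟨_, hP I hI, h⟩)
    (fun j hj => by
      obtain ⟨I, hI, h⟩ := exists_indep_eq_bound_lt_bound i j hj
      exact ⟨_, hP I hI, h⟩)
  have hxP : x ∈ indepPolytope M := by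
    rw [hJ]
    exact Set.mem_iInter₂.2 fun j hj => mem_halfSpace_iff.2 (hx j fun h => hi (h ▸ hj))
  exact hxi.not_ge (mem_indepPolytope_iff_forall_normal.1 hxP i)

end System

end MatroidPolytope

theorem mainTheorem10 {α : Type*} (M : Matroid α) [Fintype M.E] [M.Loopless] :
    affineSpan ℝ (MatroidPolytope.indepPolytope M) = ⊤ ∧
    Minimal (fun J : Set (MatroidPolytope.IneqIndex M) =>
      MatroidPolytope.indepPolytope M = ⋂ i ∈ J, MatroidPolytope.halfSpace M i) Set.univ ∧
    ∀ i : MatroidPolytope.IneqIndex M,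
      MatroidPolytope.IsFacet (MatroidPolytope.indepPolytope M)
        (MatroidPolytope.indepPolytope M ∩ MatroidPolytope.boundingHyperplane M i) :=
  ⟨(AffineSubspace.affineSpan_eq_top_iff_vectorSpan_eq_top_of_nonempty ℝ _ _
      MatroidPolytope.nonempty_indepPolytope).2 MatroidPolytope.vectorSpan_indepPolytope,
    MatroidPolytope.minimal_system, MatroidPolytope.isFacet_inter_boundingHyperplane⟩
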